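/- Consider the constant redirection (CR) model with $\alpha=\infty$ and redirection probability $r\in[0,1)$. It is a growing random tree $(G_N)_{N\ge m}$, started from an arbitrary finite tree $G_m$ with $m\ge 2$ nodes, in which $G_N$ has $N$ nodes. Given $G_m,\dots,G_N$, a new node is added to $G_N$ and joined by one edge to a node chosen as follows: an initial target $k$ is chosen uniformly among the nodes of maximum degree of $G_N$ (the kings); with probability $1-r$ the new node attaches to $k$, and with probability $r$ it attaches instead to a uniformly chosen neighbour of $k$. Then, almost surely, the highest-degree node stabilizes and its degree grows at linear rate $1-r$: there is a (random) node $k$ such that, for all sufficiently large $N$, the node $k$ is the unique node of maximum degree of $G_N$, and $$\lim_{N\to\infty}\frac{\deg_{G_N}(k)}{N}=1-r .$$ -/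

import Mathlib

open MeasureTheory Filter Topology

noncomputable section

namespace CRModel

/-- The degree of node `v` in a finite graph. -/
def deg {N : ℕ} (G : SimpleGraph (Fin N)) (v : Fin N) : ℕ :=
  (G.neighborSet v).ncard

open Classical in
/-- The kings: the nodes of maximum degree. -/
def kings {N : ℕ} (G : SimpleGraph (Fin N)) : Finset (Fin N) :=
  Finset.univ.filter fun v => ∀ w, deg G w ≤ deg G v

open Classical in
/-- Attachment probabilities of the constant redirection model at `α = ∞`. The initial target `k`
is uniform among the nodes of maximum degree (all the mass of `d ^ α` as `α → ∞`). With probability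
`1 - r` the new node attaches to `k`, with probability `r` it is redirected to a uniformly chosen
neighbour of `k`. The value is the probability that the new node attaches to `v`. -/
def attachProb (r : ℝ) {N : ℕ} (G : SimpleGraph (Fin N)) (v : Fin N) : ℝ :=
  ∑ k ∈ kings G, (1 / ((kings G).card : ℝ)) *
    ((1 - r) * (if v = k then 1 else 0) + r * (if G.Adj k v then 1 / (deg G k : ℝ) else 0))

/-- The graph obtained by adding a new node, labelled `N`, joined by one edge to node `v`.
Nodes keep their labels, so a node is identified by its label throughout the process. -/
def attach {N : ℕ} (G : SimpleGraph (Fin N)) (v : Fin N) : SimpleGraph (Fin (N + 1)) :=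
  G.map Fin.castSuccEmb ⊔ SimpleGraph.edge v.castSucc (Fin.last N)

/-- The event that the process follows the history `h` at all sizes from `m` to `N`. -/
def historyEvent {Ω : Type*} (m : ℕ) (G : (N : ℕ) → Ω → SimpleGraph (Fin N))
    (h : (N : ℕ) → SimpleGraph (Fin N)) (N : ℕ) : Set Ω :=
  {ω | ∀ k, m ≤ k → k ≤ N → G k ω = h k}

/-- `G` is a realization, on the probability space `(Ω, μ)`, of the constant redirection model with
`α = ∞` and redirection probability `r`, started from the graph `T` on `m` nodes; `G N` is the
graph at size `N` (only the sizes `N ≥ m` matter). Given the whole history up to size `N`, the node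
added next attaches to node `v` with probability `attachProb r (G N) v`. -/
structure IsProcess {Ω : Type*} [MeasurableSpace Ω] (μ : Measure Ω) (r : ℝ) {m : ℕ}
    (T : SimpleGraph (Fin m)) (G : (N : ℕ) → Ω → SimpleGraph (Fin N)) : Prop where
  measurable : ∀ N, m ≤ N → ∀ g : SimpleGraph (Fin N), MeasurableSet {ω | G N ω = g}
  initial : ∀ᵐ ω ∂μ, G m ω = T
  step : ∀ N, m ≤ N → ∀ (h : (k : ℕ) → SimpleGraph (Fin k)) (v : Fin N),
    μ.real (historyEvent m G h N ∩ {ω | G (N + 1) ω = attach (h N) v})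
      = μ.real (historyEvent m G h N) * attachProb r (h N) v

/-- The node labelled `k` is present and is the unique node of maximum degree. -/
def IsUniqueKing {N : ℕ} (G : SimpleGraph (Fin N)) (k : ℕ) : Prop :=
  ∃ hk : k < N, ∀ w : Fin N, w ≠ ⟨k, hk⟩ → deg G w < deg G ⟨k, hk⟩

/-- The degree of the node labelled `k`, and `0` while that node is not yet present. -/
def labelDeg {N : ℕ} (G : SimpleGraph (Fin N)) (k : ℕ) : ℕ :=
  if hk : k < N then deg G ⟨k, hk⟩ else 0

end CRModel

end

/-! Everything is controlled by the potential `excess`: the sum over all nodes of 2^(deg - maxDeg),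
minus 1 for one king. Hitting a king, which has probability at least 1 - r, halves it up to an error
2^(-maxDeg). A non-king is reached only by redirection, with probability at most r / maxDeg, so such
hits raise the expected potential by at most excess / maxDeg plus errors of order 2^(-maxDeg). Since
E 2^(-maxDeg) decays geometrically, so does the expected excess (`IsProcess.stateExp_excess_le`).

A tie forces excess ≥ 1, so Markov's inequality and Borel–Cantelli leave only finitely many ties.
Degrees rise by at most one per step, so the leader cannot change without a tie
(`IsUniqueKing.attach`); hence one node is eventually the only king.

For the rate, maxDeg - (1 - r) N has zero drift when the king is unique, and the effect of ties is
paid for by the excess. Its second moment is therefore O(N) (`IsProcess.stateExp_sq_le`). Chebyshev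
along the squares, and monotonicity of maxDeg between them, give the limit. -/

noncomputable section

namespace CRModel

/-! ### Degrees, kings and the potential under one attachment. -/

section Graph

variable {N : ℕ}

lemma mem_kings {G : SimpleGraph (Fin N)} {v : Fin N} :
    v ∈ kings G ↔ ∀ w, deg G w ≤ deg G v := by
  simp [kings]

/-- The maximum degree of a finite graph. -/
def maxDeg (G : SimpleGraph (Fin N)) : ℕ := Finset.univ.sup (deg G)

lemma deg_le_maxDeg (G : SimpleGraph (Fin N)) (v : Fin N) : deg G v ≤ maxDeg G :=
  Finset.le_sup (f := deg G) (Finset.mem_univ v)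

lemma mem_kings_iff_deg_eq {G : SimpleGraph (Fin N)} {v : Fin N} :
    v ∈ kings G ↔ deg G v = maxDeg G := by
  rw [mem_kings]
  refine ⟨fun h => le_antisymm (deg_le_maxDeg G v) (Finset.sup_le fun w _ => h w), fun h w => ?_⟩
  rw [h]
  exact deg_le_maxDeg G w

lemma pos_of_maxDeg_pos {G : SimpleGraph (Fin N)} (h : 1 ≤ maxDeg G) : 0 < N := by
  rcases Nat.eq_zero_or_pos N with rfl | h0
  · simp [maxDeg] at h
  · exact h0

lemma kings_nonempty {G : SimpleGraph (Fin N)} (hN : 0 < N) : (kings G).Nonempty := by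
  have : (Finset.univ : Finset (Fin N)).Nonempty := ⟨⟨0, hN⟩, Finset.mem_univ _⟩
  obtain ⟨v, -, hv⟩ := Finset.exists_max_image Finset.univ (deg G) this
  exact ⟨v, mem_kings.2 fun w => hv w (Finset.mem_univ w)⟩

lemma deg_le (G : SimpleGraph (Fin N)) (v : Fin N) : deg G v ≤ N := by
  have := Set.ncard_le_card (G.neighborSet v)
  simpa [deg] using this

lemma maxDeg_le (G : SimpleGraph (Fin N)) : maxDeg G ≤ N :=
  Finset.sup_le fun v _ => deg_le G v

lemma attach_adj_castSucc (G : SimpleGraph (Fin N)) (v a b : Fin N) :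
    (attach G v).Adj a.castSucc b.castSucc ↔ G.Adj a b := by
  simp only [attach, SimpleGraph.sup_adj, SimpleGraph.map_adj, SimpleGraph.edge_adj]
  constructor
  · rintro (⟨a', b', h, ha, hb⟩ | ⟨(⟨-, h⟩ | ⟨h, -⟩), -⟩)
    · rw [Fin.coe_castSuccEmb] at ha hb
      rwa [← Fin.castSucc_injective _ ha, ← Fin.castSucc_injective _ hb]
    · exact absurd h (Fin.castSucc_lt_last _).ne
    · exact absurd h (Fin.castSucc_lt_last _).ne
  · exact fun h => Or.inl ⟨a, b, h, rfl, rfl⟩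

lemma attach_adj_last (G : SimpleGraph (Fin N)) (v a : Fin N) :
    (attach G v).Adj a.castSucc (Fin.last N) ↔ a = v := by
  simp only [attach, SimpleGraph.sup_adj, SimpleGraph.map_adj, SimpleGraph.edge_adj]
  constructor
  · rintro (⟨a', b', h, ha, hb⟩ | ⟨(⟨h, -⟩ | ⟨h, -⟩), -⟩)
    · exact absurd hb (Fin.castSucc_lt_last _).ne
    · exact Fin.castSucc_injective _ h
    · exact absurd h (Fin.castSucc_lt_last _).ne
  · rintro rfl
    exact Or.inr ⟨Or.inl (by simp), (Fin.castSucc_lt_last _).ne⟩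

/-- Lets sums over target nodes be read as sums over successor graphs. -/
lemma attach_injective (G : SimpleGraph (Fin N)) : Function.Injective (attach G) := by
  intro v w h
  have := (attach_adj_last G v v).2 rfl
  rw [h] at this
  exact (attach_adj_last G w v).1 this

lemma deg_attach_last (G : SimpleGraph (Fin N)) (v : Fin N) :
    deg (attach G v) (Fin.last N) = 1 := by
  have : (attach G v).neighborSet (Fin.last N) = {v.castSucc} := by
    ext a
    rw [SimpleGraph.mem_neighborSet, SimpleGraph.adj_comm, Set.mem_singleton_iff]
    refine Fin.lastCases ?_ (fun a => ?_) a
    · simp [(Fin.castSucc_lt_last v).ne']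
    · rw [attach_adj_last, Fin.castSucc_inj]
  rw [deg, this, Set.ncard_singleton]

lemma deg_attach_castSucc (G : SimpleGraph (Fin N)) (v w : Fin N) :
    deg (attach G v) w.castSucc = deg G w + if w = v then 1 else 0 := by
  have hlast : Fin.last N ∉ Fin.castSucc '' G.neighborSet w := by
    rintro ⟨a, -, ha⟩
    exact (Fin.castSucc_lt_last _).ne ha
  split_ifs with h
  · have : (attach G v).neighborSet w.castSucc
        = insert (Fin.last N) (Fin.castSucc '' G.neighborSet w) := by
      ext a
      rw [SimpleGraph.mem_neighborSet]
      refine Fin.lastCases ?_ (fun a => ?_) a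
      · simp [attach_adj_last, h]
      · rw [attach_adj_castSucc]
        simp [(Fin.castSucc_lt_last a).ne]
    rw [deg, this, Set.ncard_insert_of_notMem hlast,
      Set.ncard_image_of_injective _ (Fin.castSucc_injective _), deg]
  · have : (attach G v).neighborSet w.castSucc = Fin.castSucc '' G.neighborSet w := by
      ext a
      rw [SimpleGraph.mem_neighborSet]
      refine Fin.lastCases ?_ (fun a => ?_) a
      · rw [attach_adj_last]
        exact iff_of_false h hlast
      · rw [attach_adj_castSucc]
        simp
    rw [deg, this, Set.ncard_image_of_injective _ (Fin.castSucc_injective _), deg, add_zero]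

lemma maxDeg_attach_of_mem {G : SimpleGraph (Fin N)} {v : Fin N} (hv : v ∈ kings G) :
    maxDeg (attach G v) = maxDeg G + 1 := by
  refine le_antisymm (Finset.sup_le fun w _ => ?_) ?_
  · refine Fin.lastCases ?_ (fun w => ?_) w
    · rw [deg_attach_last]; omega
    · rw [deg_attach_castSucc]
      have := deg_le_maxDeg G w
      split_ifs <;> omega
  · rw [← mem_kings_iff_deg_eq.1 hv]
    have := deg_le_maxDeg (attach G v) v.castSucc
    rwa [deg_attach_castSucc, if_pos rfl] at this

lemma maxDeg_attach_of_notMem {G : SimpleGraph (Fin N)} {v : Fin N} (hG : 1 ≤ maxDeg G)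
    (hv : v ∉ kings G) : maxDeg (attach G v) = maxDeg G := by
  refine le_antisymm (Finset.sup_le fun w _ => ?_) (Finset.sup_le fun w _ => ?_)
  · refine Fin.lastCases ?_ (fun w => ?_) w
    · rwa [deg_attach_last]
    · rw [deg_attach_castSucc]
      have := deg_le_maxDeg G w
      split_ifs with h
      · rw [mem_kings_iff_deg_eq] at hv
        subst h
        omega
      · omega
  · refine le_trans ?_ (deg_le_maxDeg (attach G v) w.castSucc)
    rw [deg_attach_castSucc]
    omega

lemma maxDeg_le_maxDeg_attach (G : SimpleGraph (Fin N)) (v : Fin N) :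
    maxDeg G ≤ maxDeg (attach G v) := by
  refine Finset.sup_le fun w _ => le_trans ?_ (deg_le_maxDeg (attach G v) w.castSucc)
  rw [deg_attach_castSucc]
  omega

section attachProb

variable {r : ℝ} {G : SimpleGraph (Fin N)}

lemma attachProb_nonneg (hr0 : 0 ≤ r) (hr1 : r < 1) (v : Fin N) : 0 ≤ attachProb r G v := by
  refine Finset.sum_nonneg fun k _ => mul_nonneg (by positivity) (add_nonneg ?_ ?_)
  · exact mul_nonneg (by linarith) (by split_ifs <;> norm_num)
  · exact mul_nonneg hr0 (by split_ifs <;> positivity)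

lemma sum_kings_inv_card (hN : 0 < N) : ∑ _k ∈ kings G, (1 / ((kings G).card : ℝ)) = 1 := by
  have : ((kings G).card : ℝ) ≠ 0 := by
    exact_mod_cast (Finset.card_pos.2 (kings_nonempty hN)).ne'
  rw [Finset.sum_const, nsmul_eq_mul]
  field_simp

open Classical in
lemma sum_adj_inv_deg {k : Fin N} (hk : 1 ≤ deg G k) :
    ∑ v, (if G.Adj k v then 1 / (deg G k : ℝ) else 0) = 1 := by
  rw [← Finset.sum_filter, Finset.sum_const, nsmul_eq_mul]
  have : (Finset.univ.filter fun v => G.Adj k v).card = deg G k := by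
    rw [deg, Set.ncard_eq_toFinset_card']
    congr 1
    ext v
    simp
  rw [this]
  have : (deg G k : ℝ) ≠ 0 := by exact_mod_cast (by omega : deg G k ≠ 0)
  field_simp

lemma sum_attachProb (hG : 1 ≤ maxDeg G) : ∑ v, attachProb r G v = 1 := by
  classical
  simp only [attachProb]
  rw [Finset.sum_comm]
  refine Eq.trans ?_ (sum_kings_inv_card (pos_of_maxDeg_pos hG) (G := G))
  refine Finset.sum_congr rfl fun k hk => ?_
  rw [← Finset.mul_sum, Finset.sum_add_distrib, ← Finset.mul_sum, ← Finset.mul_sum,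
    sum_adj_inv_deg (by rwa [mem_kings_iff_deg_eq.1 hk])]
  simp

/-- Direct attachment alone contributes 1 - r; redirection between adjacent tied kings can only add
to it. -/
lemma le_sum_kings_attachProb (hr0 : 0 ≤ r) (hN : 0 < N) :
    1 - r ≤ ∑ v ∈ kings G, attachProb r G v := by
  classical
  simp only [attachProb]
  rw [Finset.sum_comm]
  calc 1 - r = ∑ k ∈ kings G, (1 / ((kings G).card : ℝ)) * (1 - r) := by
        rw [← Finset.sum_mul, sum_kings_inv_card hN, one_mul]
    _ ≤ _ := by
        refine Finset.sum_le_sum fun k hk => ?_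
        rw [← Finset.mul_sum, Finset.sum_add_distrib, ← Finset.mul_sum, Finset.sum_ite_eq',
          if_pos hk, mul_one]
        refine mul_le_mul_of_nonneg_left (le_add_of_nonneg_right ?_) (by positivity)
        refine Finset.sum_nonneg fun v _ => mul_nonneg hr0 ?_
        split_ifs <;> positivity

/-- A sole king is not its own neighbour, so redirection always lands outside the kings. -/
lemma sum_kings_attachProb_eq (h : (kings G).card = 1) :
    ∑ v ∈ kings G, attachProb r G v = 1 - r := by
  obtain ⟨k, hk⟩ := Finset.card_eq_one.1 h
  simp [attachProb, hk]

/-- Only redirection reaches a non-king, and every king spreads it evenly over `maxDeg G`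
neighbours. -/
lemma attachProb_le (hr0 : 0 ≤ r) (hN : 0 < N) {v : Fin N} (hv : v ∉ kings G) :
    attachProb r G v ≤ r / maxDeg G := by
  classical
  calc attachProb r G v ≤ ∑ k ∈ kings G, (1 / ((kings G).card : ℝ)) * (r / maxDeg G) := by
        refine Finset.sum_le_sum fun k hk => mul_le_mul_of_nonneg_left ?_ (by positivity)
        have : v ≠ k := by rintro rfl; exact hv hk
        rw [if_neg this, mul_zero, zero_add, mem_kings_iff_deg_eq.1 hk, div_eq_mul_one_div r]
        refine mul_le_mul_of_nonneg_left ?_ hr0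
        split_ifs
        · exact le_rfl
        · positivity
    _ = _ := by rw [← Finset.sum_mul, sum_kings_inv_card hN, one_mul]

end attachProb

/-- The exponentially weighted number of nodes other than one king, weighted by the degree gap. -/
def excess (G : SimpleGraph (Fin N)) : ℝ := (∑ w, (2 : ℝ) ^ deg G w) / 2 ^ maxDeg G - 1

lemma card_kings_add_sum_compl (G : SimpleGraph (Fin N)) :
    ((kings G).card : ℝ) + (∑ w ∈ (kings G)ᶜ, (2 : ℝ) ^ deg G w) / 2 ^ maxDeg G
      = excess G + 1 := by
  have h2 : (2 : ℝ) ^ maxDeg G ≠ 0 := by positivity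
  have h : ∑ w ∈ kings G, (2 : ℝ) ^ deg G w = (kings G).card * 2 ^ maxDeg G := by
    rw [← nsmul_eq_mul, ← Finset.sum_const]
    exact Finset.sum_congr rfl fun w hw => by rw [mem_kings_iff_deg_eq.1 hw]
  rw [excess, ← Finset.sum_add_sum_compl (kings G), h]
  field_simp
  ring

lemma excess_le (G : SimpleGraph (Fin N)) : excess G ≤ N := by
  have : (∑ w, (2 : ℝ) ^ deg G w) / 2 ^ maxDeg G ≤ N := by
    rw [div_le_iff₀ (by positivity)]
    calc ∑ w, (2 : ℝ) ^ deg G w ≤ ∑ _w : Fin N, (2 : ℝ) ^ maxDeg G :=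
          Finset.sum_le_sum fun w _ => pow_le_pow_right₀ (by norm_num) (deg_le_maxDeg G w)
      _ = _ := by simp
  unfold excess
  linarith

lemma excess_nonneg {G : SimpleGraph (Fin N)} (hN : 0 < N) : 0 ≤ excess G := by
  have h1 : (1 : ℝ) ≤ (kings G).card := by
    exact_mod_cast Finset.card_pos.2 (kings_nonempty hN)
  have h2 : 0 ≤ (∑ w ∈ (kings G)ᶜ, (2 : ℝ) ^ deg G w) / 2 ^ maxDeg G := by positivity
  linarith [card_kings_add_sum_compl G]

/-- Each king weighs exactly 1 in the normalized sum, so a second one survives the subtraction. This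
makes ties accessible to Markov's inequality. -/
lemma one_le_excess {G : SimpleGraph (Fin N)} (hN : 0 < N) (h : (kings G).card ≠ 1) :
    1 ≤ excess G := by
  have h0 := Finset.card_pos.2 (kings_nonempty (G := G) hN)
  have h1 : (2 : ℝ) ≤ (kings G).card := by exact_mod_cast (by omega : 2 ≤ (kings G).card)
  have h2 : 0 ≤ (∑ w ∈ (kings G)ᶜ, (2 : ℝ) ^ deg G w) / 2 ^ maxDeg G := by positivity
  linarith [card_kings_add_sum_compl G]

lemma sum_compl_kings_le {G : SimpleGraph (Fin N)} (hN : 0 < N) :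
    ∑ w ∈ (kings G)ᶜ, (2 : ℝ) ^ deg G w / 2 ^ maxDeg G ≤ excess G := by
  have h1 : (1 : ℝ) ≤ (kings G).card := by
    exact_mod_cast Finset.card_pos.2 (kings_nonempty hN)
  rw [← Finset.sum_div]
  linarith [card_kings_add_sum_compl G]

lemma sum_two_pow_deg_attach (G : SimpleGraph (Fin N)) (v : Fin N) :
    ∑ w, (2 : ℝ) ^ deg (attach G v) w = (∑ w, (2 : ℝ) ^ deg G w) + 2 ^ deg G v + 2 := by
  rw [Fin.sum_univ_castSucc, deg_attach_last]
  have : ∀ w, (2 : ℝ) ^ deg (attach G v) w.castSucc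
      = 2 ^ deg G w + if w = v then 2 ^ deg G v else 0 := by
    intro w
    rw [deg_attach_castSucc]
    split_ifs with h
    · subst h; ring
    · simp
  simp [this, Finset.sum_add_distrib]

/-- The denominator doubles; the king's own growth keeps its weight at 1, and the remaining term is
the new leaf. -/
lemma excess_attach_of_mem {G : SimpleGraph (Fin N)} {v : Fin N} (hv : v ∈ kings G) :
    excess (attach G v) = excess G / 2 + (1 / 2) ^ maxDeg G := by
  rw [excess, sum_two_pow_deg_attach, maxDeg_attach_of_mem hv, mem_kings_iff_deg_eq.1 hv, excess,
    one_div_pow, pow_succ]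
  field_simp
  ring

lemma excess_attach_of_notMem {G : SimpleGraph (Fin N)} {v : Fin N} (hG : 1 ≤ maxDeg G)
    (hv : v ∉ kings G) :
    excess (attach G v) = excess G + 2 ^ deg G v / 2 ^ maxDeg G + 2 * (1 / 2) ^ maxDeg G := by
  rw [excess, sum_two_pow_deg_attach, maxDeg_attach_of_notMem hG hv, excess, one_div_pow]
  field_simp
  ring

lemma labelDeg_of_isUniqueKing {G : SimpleGraph (Fin N)} {k : ℕ} (h : IsUniqueKing G k) :
    labelDeg G k = maxDeg G := by
  obtain ⟨hk, h⟩ := h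
  rw [labelDeg, dif_pos hk, ← mem_kings_iff_deg_eq, mem_kings]
  intro w
  by_cases hw : w = ⟨k, hk⟩
  · rw [hw]
  · exact (h w hw).le

lemma isUniqueKing_of_kings_eq {G : SimpleGraph (Fin N)} {k : Fin N} (h : kings G = {k}) :
    IsUniqueKing G k := by
  refine ⟨k.2, fun w hw => ?_⟩
  have hk : k ∈ kings G := by simp [h]
  have hw' : w ∉ kings G := by simpa [h] using hw
  refine lt_of_le_of_ne (mem_kings.1 hk w) fun he => hw' ?_
  rw [mem_kings_iff_deg_eq, he]
  exact mem_kings_iff_deg_eq.1 hk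

/-- A strict leader can be caught in one step but not overtaken, so it stays among the kings; the
absence of a tie then makes it the only one. -/
lemma IsUniqueKing.attach {G : SimpleGraph (Fin N)} {k : ℕ} (hG : 1 ≤ maxDeg G)
    (h : IsUniqueKing G k) {v : Fin N} (hc : (kings (attach G v)).card = 1) :
    IsUniqueKing (attach G v) k := by
  have hm := labelDeg_of_isUniqueKing h
  obtain ⟨hk, h⟩ := h
  rw [labelDeg, dif_pos hk] at hm
  have hmem : (⟨k, hk⟩ : Fin N).castSucc ∈ kings (CRModel.attach G v) := by
    rw [mem_kings]
    intro w
    rw [deg_attach_castSucc]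
    refine Fin.lastCases ?_ (fun w => ?_) w
    · rw [deg_attach_last]; omega
    · rw [deg_attach_castSucc]
      by_cases hw : w = ⟨k, hk⟩
      · rw [hw]
      · have := h w hw
        split_ifs <;> omega
  obtain ⟨k', hk'⟩ := Finset.card_eq_one.1 hc
  have : (⟨k, hk⟩ : Fin N).castSucc = k' := by simpa [hk'] using hmem
  have h3 := isUniqueKing_of_kings_eq hk'
  rwa [← this] at h3

end Graph

/-! ### The Markov property and expectations over the finite state space. -/

section Markov

variable {Ω : Type*} [MeasurableSpace Ω] {μ : Measure Ω} {r : ℝ} {m : ℕ}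
  {T : SimpleGraph (Fin m)} {G : (N : ℕ) → Ω → SimpleGraph (Fin N)}

lemma IsProcess.measurableSet (hG : IsProcess μ r T G) {N : ℕ} (hN : m ≤ N)
    (p : SimpleGraph (Fin N) → Prop) : MeasurableSet {ω | p (G N ω)} := by
  have : {ω | p (G N ω)} = ⋃ g ∈ {g | p g}, {ω | G N ω = g} := by ext; simp
  rw [this]
  exact MeasurableSet.biUnion (Set.to_countable _) fun g _ => hG.measurable N hN g

lemma IsProcess.measurableSet_historyEvent (hG : IsProcess μ r T G) {j : ℕ} (hj : m ≤ j)
    (h : (N : ℕ) → SimpleGraph (Fin N)) (N : ℕ) : MeasurableSet (historyEvent j G h N) := by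
  have : historyEvent j G h N = ⋂ k, ⋂ (_ : j ≤ k), ⋂ (_ : k ≤ N), {ω | G k ω = h k} := by
    ext; simp [historyEvent]
  rw [this]
  exact .iInter fun k => .iInter fun hk => .iInter fun _ => hG.measurable k (hj.trans hk) _

lemma measureReal_eq_sum_inter [IsFiniteMeasure μ] (hG : IsProcess μ r T G) {N : ℕ} (hN : m ≤ N)
    {s : Set Ω} (hs : MeasurableSet s) :
    μ.real s = ∑ g, μ.real (s ∩ {ω | G N ω = g}) := by
  rw [← measureReal_iUnion_fintype]
  · congr 1
    ext; simp
  · intro g g' hgg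
    refine Set.disjoint_left.2 fun ω h1 h2 => hgg ?_
    exact h1.2.symm.trans h2.2
  · exact fun g => hs.inter (hG.measurable N hN g)

/-- The transition rule holds given any final segment of the history. -/
lemma IsProcess.step_of_le [IsFiniteMeasure μ] (hG : IsProcess μ r T G) {N j : ℕ} (hj : m ≤ j)
    (hjN : j ≤ N) (h : (k : ℕ) → SimpleGraph (Fin k)) (v : Fin N) :
    μ.real (historyEvent j G h N ∩ {ω | G (N + 1) ω = attach (h N) v})
      = μ.real (historyEvent j G h N) * attachProb r (h N) v := by
  induction j, hj using Nat.le_induction generalizing h with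
  | base => exact hG.step N hjN h v
  | succ j hj ih =>
    have hA : MeasurableSet {ω | G (N + 1) ω = attach (h N) v} :=
      hG.measurable _ (by omega) _
    have hH := hG.measurableSet_historyEvent (j := j + 1) (by omega) h N
    have hN : ∀ g : SimpleGraph (Fin j), Function.update h j g N = h N := by
      intro g
      rw [Function.update_of_ne (by omega)]
    -- Fixing the graph at size j extends the shorter history backwards by one; summing over all its
    -- values recovers the shorter history.
    have hinter : ∀ g, historyEvent (j + 1) G h N ∩ {ω | G j ω = g}
        = historyEvent j G (Function.update h j g) N := by
      intro g
      ext ω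
      simp only [historyEvent, Set.mem_inter_iff, Set.mem_ofPred_eq]
      constructor
      · rintro ⟨h1, h2⟩ k hk hkN
        rcases hk.eq_or_lt with rfl | hk
        · rw [h2, Function.update_self]
        · rw [h1 k hk hkN, Function.update_of_ne (by omega)]
      · intro h1
        refine ⟨fun k hk hkN => ?_, ?_⟩
        · rw [h1 k (by omega) hkN, Function.update_of_ne (by omega)]
        · rw [h1 j le_rfl (by omega), Function.update_self]
    rw [measureReal_eq_sum_inter hG hj (hH.inter hA), measureReal_eq_sum_inter hG hj hH,
      Finset.sum_mul]
    refine Finset.sum_congr rfl fun g _ => ?_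
    rw [Set.inter_right_comm, hinter, ← hN g]
    exact ih (by omega) _

/-- The Markov property of the process. -/
lemma IsProcess.markov [IsFiniteMeasure μ] (hG : IsProcess μ r T G) {N : ℕ} (hN : m ≤ N)
    (g : SimpleGraph (Fin N)) (v : Fin N) :
    μ.real ({ω | G N ω = g} ∩ {ω | G (N + 1) ω = attach g v})
      = μ.real {ω | G N ω = g} * attachProb r g v := by
  have h := hG.step_of_le hN le_rfl (Function.update (fun k => ⊥) N g) v
  have : historyEvent N G (Function.update (fun k => ⊥) N g) N = {ω | G N ω = g} := by
    ext ω
    simp only [historyEvent, Set.mem_ofPred_eq]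
    constructor
    · intro h
      simpa using h N le_rfl le_rfl
    · intro h k h1 h2
      obtain rfl : k = N := le_antisymm h2 h1
      simpa using h
  rwa [this, Function.update_self] at h

/-- The process axioms prescribe only the probabilities of attachments. When the maximum degree is
positive these already sum to 1, so no mass is left for any other successor. -/
lemma IsProcess.measureReal_inter_eq_zero [IsFiniteMeasure μ] (hG : IsProcess μ r T G) {N : ℕ}
    (hN : m ≤ N) {g : SimpleGraph (Fin N)} (hg : 1 ≤ maxDeg g) {g' : SimpleGraph (Fin (N + 1))}
    (hg' : g' ∉ Set.range (attach g)) :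
    μ.real ({ω | G N ω = g} ∩ {ω | G (N + 1) ω = g'}) = 0 := by
  classical
  have h1 := measureReal_eq_sum_inter hG (N := N + 1) (by omega) (hG.measurable N hN g)
  have h2 : ∑ v, μ.real ({ω | G N ω = g} ∩ {ω | G (N + 1) ω = attach g v})
      = μ.real {ω | G N ω = g} := by
    simp_rw [hG.markov hN, ← Finset.mul_sum, sum_attachProb hg, mul_one]
  rw [← h2, ← Finset.sum_image (g := attach g)
    (f := fun x => μ.real ({ω | G N ω = g} ∩ {ω | G (N + 1) ω = x}))
    fun a _ b _ h => attach_injective g h,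
    ← Finset.sum_add_sum_compl (Finset.univ.image (attach g))] at h1
  have h3 := (Finset.sum_eq_zero_iff_of_nonneg fun x _ => measureReal_nonneg).1
    (left_eq_add.1 h1)
  exact h3 g' (by simpa using hg')

lemma measureReal_state_eq_zero_iff [IsFiniteMeasure μ] (N : ℕ) (g : SimpleGraph (Fin N)) :
    μ.real {ω | G N ω = g} = 0 ↔ ∀ᵐ ω ∂μ, G N ω ≠ g := by
  rw [measureReal_eq_zero_iff, ae_iff]
  simp only [ne_eq, not_not]

lemma IsProcess.ae_attach_of_ae [IsFiniteMeasure μ] (hG : IsProcess μ r T G) {N : ℕ}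
    (hN : m ≤ N) (h : ∀ᵐ ω ∂μ, 1 ≤ maxDeg (G N ω)) :
    ∀ᵐ ω ∂μ, ∃ v, G (N + 1) ω = attach (G N ω) v := by
  have h1 : ∀ g, 1 ≤ maxDeg g → ∀ g' ∉ Set.range (attach g),
      ∀ᵐ ω ∂μ, ¬ (G N ω = g ∧ G (N + 1) ω = g') := by
    intro g hg g' hg'
    have := hG.measureReal_inter_eq_zero hN hg hg'
    rw [measureReal_eq_zero_iff] at this
    rw [ae_iff]
    simpa [Set.ofPred_and] using this
  have h2 : ∀ᵐ ω ∂μ, ∀ g, 1 ≤ maxDeg g → ∀ g' ∉ Set.range (attach g),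
      ¬ (G N ω = g ∧ G (N + 1) ω = g') := by
    rw [ae_all_iff]; intro g
    rw [ae_all_iff]; intro hg
    rw [ae_all_iff]; intro g'
    rw [ae_all_iff]; intro hg'
    exact h1 g hg g' hg'
  filter_upwards [h, h2] with ω h3 h4
  by_contra h5
  exact h4 _ h3 _ (fun ⟨v, hv⟩ => h5 ⟨v, hv.symm⟩) ⟨rfl, rfl⟩

lemma one_le_maxDeg_of_isTree (hm : 2 ≤ m) (hT : T.IsTree) : 1 ≤ maxDeg T := by
  have : Nontrivial (Fin m) := Fin.nontrivial_iff_two_le.2 hm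
  let v : Fin m := ⟨0, by omega⟩
  obtain ⟨u, hu⟩ := hT.connected.preconnected.exists_adj_of_nontrivial v
  refine le_trans ?_ (deg_le_maxDeg T v)
  exact (Set.ncard_pos (Set.toFinite _)).2 ⟨u, hu⟩

lemma IsProcess.ae_one_le_maxDeg [IsFiniteMeasure μ] (hG : IsProcess μ r T G) (hm : 2 ≤ m)
    (hT : T.IsTree) {N : ℕ} (hN : m ≤ N) : ∀ᵐ ω ∂μ, 1 ≤ maxDeg (G N ω) := by
  induction N, hN using Nat.le_induction with
  | base =>
    filter_upwards [hG.initial] with ω h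
    rw [h]
    exact one_le_maxDeg_of_isTree hm hT
  | succ N hN ih =>
    filter_upwards [ih, hG.ae_attach_of_ae hN ih] with ω h1 ⟨v, h2⟩
    rw [h2]
    exact h1.trans (maxDeg_le_maxDeg_attach _ _)

/-- The expectation of `f (G N)`. -/
def stateExp (μ : Measure Ω) (G : (N : ℕ) → Ω → SimpleGraph (Fin N)) (N : ℕ)
    (f : SimpleGraph (Fin N) → ℝ) : ℝ :=
  ∑ g, μ.real {ω | G N ω = g} * f g

/-- States of maximum degree 0 carry no mass, so pointwise bounds are needed only on the others. -/
lemma stateExp_mono {N : ℕ} {f f' : SimpleGraph (Fin N) → ℝ}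
    (hpos : ∀ᵐ ω ∂μ, 1 ≤ maxDeg (G N ω)) [IsFiniteMeasure μ]
    (h : ∀ g, 1 ≤ maxDeg g → f g ≤ f' g) : stateExp μ G N f ≤ stateExp μ G N f' := by
  refine Finset.sum_le_sum fun g _ => ?_
  by_cases hg : 1 ≤ maxDeg g
  · exact mul_le_mul_of_nonneg_left (h g hg) measureReal_nonneg
  · have : μ.real {ω | G N ω = g} = 0 := by
      rw [measureReal_state_eq_zero_iff]
      filter_upwards [hpos] with ω h1 h2
      exact hg (h2 ▸ h1)
    simp [this]

lemma stateExp_add {N : ℕ} (f f' : SimpleGraph (Fin N) → ℝ) :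
    stateExp μ G N (fun g => f g + f' g) = stateExp μ G N f + stateExp μ G N f' := by
  simp [stateExp, mul_add, Finset.sum_add_distrib]

lemma stateExp_const_mul {N : ℕ} (c : ℝ) (f : SimpleGraph (Fin N) → ℝ) :
    stateExp μ G N (fun g => c * f g) = c * stateExp μ G N f := by
  simp [stateExp, mul_left_comm _ c, Finset.mul_sum]

lemma stateExp_one [IsProbabilityMeasure μ] (hG : IsProcess μ r T G) {N : ℕ} (hN : m ≤ N) :
    stateExp μ G N (fun _ => 1) = 1 := by
  have := measureReal_eq_sum_inter hG hN MeasurableSet.univ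
  simpa [stateExp] using this.symm

/-- Markov's inequality. -/
lemma IsProcess.measureReal_le_stateExp [IsFiniteMeasure μ] (hG : IsProcess μ r T G) {N : ℕ}
    (hN : m ≤ N) (hpos : ∀ᵐ ω ∂μ, 1 ≤ maxDeg (G N ω)) {f : SimpleGraph (Fin N) → ℝ}
    (hf : ∀ g, 1 ≤ maxDeg g → 0 ≤ f g) (p : SimpleGraph (Fin N) → Prop)
    (hp : ∀ g, 1 ≤ maxDeg g → p g → 1 ≤ f g) :
    μ.real {ω | p (G N ω)} ≤ stateExp μ G N f := by
  classical
  refine le_trans (le_of_eq ?_)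
    (stateExp_mono (f := fun g => if p g then 1 else 0) hpos fun g hg => ?_)
  · rw [measureReal_eq_sum_inter hG hN (hG.measurableSet hN p), stateExp]
    refine Finset.sum_congr rfl fun g _ => ?_
    split_ifs with h
    · rw [mul_one]
      congr 1
      ext ω
      simp only [Set.mem_inter_iff, Set.mem_ofPred_eq, and_iff_right_iff_imp]
      rintro rfl
      exact h
    · rw [mul_zero]
      convert measureReal_empty (μ := μ)
      ext ω
      simp only [Set.mem_inter_iff, Set.mem_ofPred_eq, Set.mem_empty_iff_false, iff_false, not_and]
      rintro h1 rfl
      exact h h1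
  · split_ifs with h
    · exact hp g hg h
    · exact hf g hg

/-- Converts a deterministic one-step drift bound into an inequality between successive
expectations. -/
lemma IsProcess.stateExp_succ_le [IsFiniteMeasure μ] (hG : IsProcess μ r T G) {N : ℕ}
    (hN : m ≤ N) (hpos : ∀ᵐ ω ∂μ, 1 ≤ maxDeg (G N ω)) (f : SimpleGraph (Fin (N + 1)) → ℝ)
    {f' : SimpleGraph (Fin N) → ℝ}
    (h : ∀ g, 1 ≤ maxDeg g → ∑ v, attachProb r g v * f (attach g v) ≤ f' g) :
    stateExp μ G (N + 1) f ≤ stateExp μ G N f' := by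
  classical
  have h0 : stateExp μ G (N + 1) f
      = ∑ g, ∑ g', μ.real ({ω | G N ω = g} ∩ {ω | G (N + 1) ω = g'}) * f g' := by
    rw [Finset.sum_comm, stateExp]
    refine Finset.sum_congr rfl fun g' _ => ?_
    rw [measureReal_eq_sum_inter hG hN (hG.measurable (N + 1) (by omega) g'), Finset.sum_mul]
    simp_rw [Set.inter_comm]
  rw [h0]
  refine Finset.sum_le_sum fun g _ => ?_
  by_cases hg : 1 ≤ maxDeg g
  · rw [← Finset.sum_subset (Finset.subset_univ (Finset.univ.image (attach g))),
      Finset.sum_image fun a _ b _ h => attach_injective g h]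
    · simp_rw [hG.markov hN, mul_assoc, ← Finset.mul_sum]
      exact mul_le_mul_of_nonneg_left (h g hg) measureReal_nonneg
    · intro g' _ hg'
      rw [hG.measureReal_inter_eq_zero hN hg (by simpa using hg'), zero_mul]
  · have h1 : μ.real {ω | G N ω = g} = 0 := by
      rw [measureReal_state_eq_zero_iff]
      filter_upwards [hpos] with ω h1 h2
      exact hg (h2 ▸ h1)
    rw [h1, zero_mul]
    refine (Finset.sum_eq_zero fun g' _ => ?_).le
    rw [le_antisymm ((measureReal_mono Set.inter_subset_left).trans h1.le) measureReal_nonneg,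
      zero_mul]

end Markov

/-! ### One-step drift bounds. -/

section OneStep

variable {N : ℕ} {r : ℝ} {g : SimpleGraph (Fin N)}

lemma sum_compl_kings_attachProb (hg : 1 ≤ maxDeg g) :
    ∑ v ∈ (kings g)ᶜ, attachProb r g v = 1 - ∑ v ∈ kings g, attachProb r g v := by
  rw [← sum_attachProb hg (r := r), ← Finset.sum_add_sum_compl (kings g)]
  ring

lemma sum_kings_attachProb_le_one (hr0 : 0 ≤ r) (hr1 : r < 1) (hg : 1 ≤ maxDeg g) :
    ∑ v ∈ kings g, attachProb r g v ≤ 1 := by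
  have := sum_compl_kings_attachProb hg (r := r)
  have h : 0 ≤ ∑ v ∈ (kings g)ᶜ, attachProb r g v :=
    Finset.sum_nonneg fun v _ => attachProb_nonneg hr0 hr1 v
  linarith

lemma sum_attachProb_mul_eq (hg : 1 ≤ maxDeg g) (F : ℕ → ℝ) :
    ∑ v, attachProb r g v * F (maxDeg (attach g v))
      = (∑ v ∈ kings g, attachProb r g v) * F (maxDeg g + 1)
        + (1 - ∑ v ∈ kings g, attachProb r g v) * F (maxDeg g) := by
  rw [← sum_compl_kings_attachProb hg, ← Finset.sum_add_sum_compl (kings g), Finset.sum_mul,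
    Finset.sum_mul]
  congr 1
  · exact Finset.sum_congr rfl fun v hv => by rw [maxDeg_attach_of_mem hv]
  · refine Finset.sum_congr rfl fun v hv => ?_
    rw [maxDeg_attach_of_notMem hg (Finset.mem_compl.1 hv)]

/-- With p ≥ 1 - r the chance of hitting a king, the factor is p/2 + (1 - p) ≤ (1 + r)/2. -/
lemma sum_attachProb_mul_half_pow_le (hr0 : 0 ≤ r) (hg : 1 ≤ maxDeg g) :
    ∑ v, attachProb r g v * (1 / 2 : ℝ) ^ maxDeg (attach g v)
      ≤ (1 + r) / 2 * (1 / 2 : ℝ) ^ maxDeg g := by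
  rw [sum_attachProb_mul_eq hg fun n => (1 / 2 : ℝ) ^ n, pow_succ]
  have h1 := le_sum_kings_attachProb hr0 (pos_of_maxDeg_pos hg) (G := g)
  have h2 : (0 : ℝ) < (1 / 2) ^ maxDeg g := by positivity
  nlinarith

/-- Above the threshold L the factor 1 / maxDeg is at most ε. Below it, the crude bound excess ≤ N
is absorbed by the last term, since 2^L 2^(-maxDeg) ≥ 1 there. -/
lemma excess_div_maxDeg_le {ε : ℝ} (L : ℕ) (hε : 0 ≤ ε) (hL : 1 / ((L : ℝ) + 1) ≤ ε)
    (hg : 1 ≤ maxDeg g) :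
    excess g / maxDeg g ≤ ε * excess g + 2 ^ L * N * (1 / 2) ^ maxDeg g := by
  have h0 := excess_nonneg (pos_of_maxDeg_pos hg) (G := g)
  rcases lt_or_ge L (maxDeg g) with h | h
  · have h1 : excess g / maxDeg g ≤ ε * excess g := by
      rw [div_eq_mul_one_div, mul_comm]
      refine mul_le_mul_of_nonneg_right (le_trans ?_ hL) h0
      exact one_div_le_one_div_of_le (by positivity) (by exact_mod_cast h)
    have : (0 : ℝ) ≤ 2 ^ L * N * (1 / 2) ^ maxDeg g := by positivity
    linarith
  · have h1 : excess g / maxDeg g ≤ N :=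
      (div_le_self h0 (by exact_mod_cast hg)).trans (excess_le g)
    have h2 : (1 : ℝ) ≤ 2 ^ L * (1 / 2) ^ maxDeg g := by
      rw [one_div_pow, mul_one_div, le_div_iff₀ (by positivity), one_mul]
      exact pow_le_pow_right₀ (by norm_num) h
    have h3 : (N : ℝ) ≤ N * (2 ^ L * (1 / 2) ^ maxDeg g) :=
      le_mul_of_one_le_right (Nat.cast_nonneg _) h2
    have := mul_nonneg hε h0
    nlinarith

lemma sum_attachProb_mul_excess_le {ε : ℝ} (L : ℕ) (hε : 0 ≤ ε) (hL : 1 / ((L : ℝ) + 1) ≤ ε)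
    (hr0 : 0 ≤ r) (hr1 : r < 1) (hg : 1 ≤ maxDeg g) :
    ∑ v, attachProb r g v * excess (attach g v)
      ≤ ((1 + r) / 2 + ε) * excess g + (2 + 2 ^ L * N) * (1 / 2) ^ maxDeg g := by
  have hN := pos_of_maxDeg_pos hg
  have h1 : ∑ v ∈ kings g, attachProb r g v * excess (attach g v)
      = (∑ v ∈ kings g, attachProb r g v) * (excess g / 2 + (1 / 2) ^ maxDeg g) := by
    rw [Finset.sum_mul]
    exact Finset.sum_congr rfl fun v hv => by rw [excess_attach_of_mem hv]
  have h2 : ∑ v ∈ (kings g)ᶜ, attachProb r g v * excess (attach g v)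
      ≤ (1 - ∑ v ∈ kings g, attachProb r g v) * (excess g + 2 * (1 / 2) ^ maxDeg g)
        + 1 / maxDeg g * excess g := by
    calc _ = ∑ v ∈ (kings g)ᶜ, (attachProb r g v * (excess g + 2 * (1 / 2) ^ maxDeg g)
          + attachProb r g v * (2 ^ deg g v / 2 ^ maxDeg g)) := by
          refine Finset.sum_congr rfl fun v hv => ?_
          rw [excess_attach_of_notMem hg (Finset.mem_compl.1 hv)]
          ring
      _ ≤ _ := by
          rw [Finset.sum_add_distrib, ← Finset.sum_mul, sum_compl_kings_attachProb hg]
          refine add_le_add_right ?_ _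
          refine le_trans ?_ (mul_le_mul_of_nonneg_left (sum_compl_kings_le hN) (by positivity))
          rw [Finset.mul_sum]
          refine Finset.sum_le_sum fun v hv => mul_le_mul_of_nonneg_right ?_ (by positivity)
          refine (attachProb_le hr0 hN (Finset.mem_compl.1 hv)).trans ?_
          exact div_le_div_of_nonneg_right hr1.le (Nat.cast_nonneg _)
  have h3 := excess_div_maxDeg_le L hε hL hg
  rw [div_eq_mul_one_div, mul_comm] at h3
  have h4 := le_sum_kings_attachProb hr0 hN (G := g)
  have h5 := excess_nonneg hN (G := g)
  have h6 : (0 : ℝ) < (1 / 2) ^ maxDeg g := by positivity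
  rw [← Finset.sum_add_sum_compl (kings g), h1]
  nlinarith

lemma sum_attachProb_mul_sq_le (hr0 : 0 ≤ r) (hr1 : r < 1) (hg : 1 ≤ maxDeg g) :
    ∑ v, attachProb r g v * ((maxDeg (attach g v) : ℝ) - (1 - r) * ((N : ℝ) + 1)) ^ 2
      ≤ ((maxDeg g : ℝ) - (1 - r) * N) ^ 2 + 1 + 2 * N * excess g := by
  have hN := pos_of_maxDeg_pos hg
  rw [sum_attachProb_mul_eq hg fun n => ((n : ℝ) - (1 - r) * ((N : ℝ) + 1)) ^ 2]
  have h1 := le_sum_kings_attachProb hr0 hN (G := g)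
  have h2 := sum_kings_attachProb_le_one hr0 hr1 hg
  have h0 := excess_nonneg hN (G := g)
  have hM : (maxDeg g : ℝ) ≤ N := by exact_mod_cast maxDeg_le g
  have hN0 : (0 : ℝ) ≤ N := Nat.cast_nonneg _
  have hM0 : (0 : ℝ) ≤ maxDeg g := Nat.cast_nonneg _
  -- The cross term of the square: it vanishes for a sole king, and under a tie it is at most N,
  -- hence at most N times the excess.
  have h3 : ((maxDeg g : ℝ) - (1 - r) * N) * ((∑ v ∈ kings g, attachProb r g v) - (1 - r))
      ≤ N * excess g := by
    by_cases h : (kings g).card = 1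
    · rw [sum_kings_attachProb_eq h, sub_self, mul_zero]
      positivity
    · have h4 := one_le_excess hN h
      calc _ ≤ (N : ℝ) * ((∑ v ∈ kings g, attachProb r g v) - (1 - r)) :=
            mul_le_mul_of_nonneg_right (by nlinarith) (by linarith)
        _ ≤ N * excess g := mul_le_mul_of_nonneg_left (by linarith) hN0
  push_cast
  set κ := ∑ v ∈ kings g, attachProb r g v
  set Z := (maxDeg g : ℝ) - (1 - r) * N
  have e1 : (maxDeg g : ℝ) + 1 - (1 - r) * ((N : ℝ) + 1) = Z + r := by ring
  have e2 : (maxDeg g : ℝ) - (1 - r) * ((N : ℝ) + 1) = Z - (1 - r) := by ring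
  rw [e1, e2]
  have h5 : κ * r ^ 2 + (1 - κ) * (1 - r) ^ 2 ≤ 1 := by
    have : r ^ 2 ≤ 1 := by nlinarith
    have : (1 - r) ^ 2 ≤ 1 := by nlinarith
    nlinarith
  nlinarith

end OneStep

/-! ### Real recurrences and Borel–Cantelli. -/

section Recurrence

lemma le_mul_pow_of_recurrence {a b : ℕ → ℝ} {q ρ c d : ℝ} (hq : 0 ≤ q) (hqρ : q < ρ)
    (hc : 0 ≤ c) (hd : 0 ≤ d) (ha0 : ∀ n, 0 ≤ a n) (ha : ∀ n, a (n + 1) ≤ q * a n)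
    (hb : ∀ n, b (n + 1) ≤ ρ * b n + (c + d * n) * a n) :
    ∃ D : ℝ, ∀ n, b n ≤ D * ρ ^ n := by
  have hs : 0 < ρ - q := by linarith
  -- α and β are solved for so that b n + (α + β n) a n contracts by the factor ρ: the gap ρ - q
  -- pays for the forcing term c + d n.
  obtain ⟨β, hβ⟩ : ∃ β, β = d / (ρ - q) := ⟨_, rfl⟩
  obtain ⟨α, hα⟩ : ∃ α, α = (c + q * β) / (ρ - q) := ⟨_, rfl⟩
  have hβ0 : 0 ≤ β := by rw [hβ]; positivity
  have hα0 : 0 ≤ α := by rw [hα]; positivity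
  have hβ' : β * (ρ - q) = d := by rw [hβ]; field_simp
  have hα' : α * (ρ - q) = c + q * β := by rw [hα]; field_simp
  have key : ∀ n, b n + (α + β * n) * a n ≤ (b 0 + α * a 0) * ρ ^ n := by
    intro n
    induction n with
    | zero => simp
    | succ n ih =>
      have h1 : (α + β * ((n : ℝ) + 1)) * a (n + 1) ≤ (α + β * ((n : ℝ) + 1)) * (q * a n) :=
        mul_le_mul_of_nonneg_left (ha n) (by positivity)
      have h2 := mul_le_mul_of_nonneg_left ih (hq.trans hqρ.le)
      have h3 : (c + d * n) * a n + (α + β * ((n : ℝ) + 1)) * (q * a n)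
          = ρ * ((α + β * n) * a n) := by
        rw [← hβ']
        linear_combination (- a n) * hα'
      push_cast
      rw [pow_succ]
      linarith [hb n]
  refine ⟨_, fun n => le_trans ?_ (key n)⟩
  have := ha0 n
  have : 0 ≤ (α + β * n) * a n := by positivity
  linarith

lemma le_add_of_summable_increments {V s : ℕ → ℝ} (hs0 : ∀ n, 0 ≤ s n) (hs : Summable s)
    (hV : ∀ n, V (n + 1) ≤ V n + 1 + s n) : ∃ C : ℝ, 0 ≤ C ∧ ∀ n, V n ≤ C + n := by
  have key : ∀ n, V n ≤ V 0 + n + ∑ i ∈ Finset.range n, s i := by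
    intro n
    induction n with
    | zero => simp
    | succ n ih =>
      rw [Finset.sum_range_succ]
      push_cast
      linarith [hV n]
  refine ⟨|V 0| + ∑' i, s i, add_nonneg (abs_nonneg _) (tsum_nonneg hs0), fun n => ?_⟩
  have := hs.sum_le_tsum (Finset.range n) fun i _ => hs0 i
  linarith [key n, le_abs_self (V 0)]

end Recurrence

lemma ae_eventually_of_summable {Ω : Type*} [MeasurableSpace Ω] {μ : Measure Ω}
    [IsFiniteMeasure μ] {p : ℕ → Ω → Prop} {f : ℕ → ℝ} (hf : Summable f)
    (h : ∀ n, μ.real {ω | ¬ p n ω} ≤ f n) : ∀ᵐ ω ∂μ, ∀ᶠ n in atTop, p n ω := by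
  have : ∑' n, μ {ω | ¬ p n ω} ≠ ⊤ := by
    refine ne_top_of_le_ne_top hf.tsum_ofReal_ne_top (ENNReal.tsum_le_tsum fun n => ?_)
    rw [← ofReal_measureReal]
    exact ENNReal.ofReal_le_ofReal (h n)
  filter_upwards [ae_eventually_notMem this] with ω hω
  filter_upwards [hω] with n hn
  simpa using hn

/-! ### Almost sure asymptotics. -/

section Asymptotics

variable {Ω : Type*} [MeasurableSpace Ω] {μ : Measure Ω} {r : ℝ} {m : ℕ}
  {T : SimpleGraph (Fin m)} {G : (N : ℕ) → Ω → SimpleGraph (Fin N)}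

/-- The expected excess decays geometrically. -/
lemma IsProcess.stateExp_excess_le [IsFiniteMeasure μ] (hG : IsProcess μ r T G)
    (hr0 : 0 ≤ r) (hr1 : r < 1) (hm : 2 ≤ m) (hT : T.IsTree) :
    ∃ D ρ : ℝ, 0 ≤ ρ ∧ ρ < 1 ∧ ∀ n, stateExp μ G (m + n) excess ≤ D * ρ ^ n := by
  have hpos : ∀ n, ∀ᵐ ω ∂μ, 1 ≤ maxDeg (G (m + n) ω) := fun n =>
    hG.ae_one_le_maxDeg hm hT (by omega)
  -- This ε is half the gap between (1 + r)/2 and 1, so the rate ρ = (3 + r)/4 stays below 1.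
  have hε : 0 < (1 - r) / 4 := by linarith
  obtain ⟨L, hL⟩ := exists_nat_one_div_lt hε
  obtain ⟨D, hD⟩ := le_mul_pow_of_recurrence
    (a := fun n => stateExp μ G (m + n) fun g => (1 / 2 : ℝ) ^ maxDeg g)
    (b := fun n => stateExp μ G (m + n) excess)
    (q := (1 + r) / 2) (ρ := (1 + r) / 2 + (1 - r) / 4) (c := 2 + 2 ^ L * m) (d := 2 ^ L)
    (by linarith) (by linarith) (by positivity) (by positivity)
    (fun n => Finset.sum_nonneg fun g _ => mul_nonneg measureReal_nonneg (by positivity))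
    (fun n => by
      rw [← stateExp_const_mul]
      exact hG.stateExp_succ_le (by omega) (hpos n) _ fun g hg =>
        sum_attachProb_mul_half_pow_le hr0 hg)
    (fun n => by
      rw [← stateExp_const_mul, ← stateExp_const_mul, ← stateExp_add]
      refine hG.stateExp_succ_le (by omega) (hpos n) _ fun g hg =>
        (sum_attachProb_mul_excess_le L hε.le hL.le hr0 hr1 hg).trans (le_of_eq ?_)
      push_cast
      ring)
  exact ⟨D, _, by linarith, by linarith, hD⟩

/-- Almost surely, ties for the maximum degree occur only finitely often. -/
lemma IsProcess.ae_eventually_card_kings_eq_one [IsFiniteMeasure μ] (hG : IsProcess μ r T G)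
    (hr0 : 0 ≤ r) (hr1 : r < 1) (hm : 2 ≤ m) (hT : T.IsTree) :
    ∀ᵐ ω ∂μ, ∀ᶠ n in atTop, (kings (G (m + n) ω)).card = 1 := by
  obtain ⟨D, ρ, hρ0, hρ1, hD⟩ := hG.stateExp_excess_le hr0 hr1 hm hT
  refine ae_eventually_of_summable
    ((summable_geometric_of_lt_one hρ0 hρ1).mul_left D) fun n => le_trans ?_ (hD n)
  exact hG.measureReal_le_stateExp (by omega) (hG.ae_one_le_maxDeg hm hT (by omega))
    (fun g hg => excess_nonneg (pos_of_maxDeg_pos hg)) (fun g => ¬ (kings g).card = 1)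
    fun g hg h => one_le_excess (pos_of_maxDeg_pos hg) h

/-- The second moment of the centred maximum degree grows at most linearly. -/
lemma IsProcess.stateExp_sq_le [IsProbabilityMeasure μ] (hG : IsProcess μ r T G)
    (hr0 : 0 ≤ r) (hr1 : r < 1) (hm : 2 ≤ m) (hT : T.IsTree) :
    ∃ C : ℝ, 0 ≤ C ∧ ∀ n : ℕ, stateExp μ G (m + n)
      (fun g => ((maxDeg g : ℝ) - (1 - r) * (m + n : ℕ)) ^ 2) ≤ C + n := by
  obtain ⟨D, ρ, hρ0, hρ1, hD⟩ := hG.stateExp_excess_le hr0 hr1 hm hT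
  have hpos : ∀ n, ∀ᵐ ω ∂μ, 1 ≤ maxDeg (G (m + n) ω) := fun n =>
    hG.ae_one_le_maxDeg hm hT (by omega)
  have hb0 : ∀ n, 0 ≤ stateExp μ G (m + n) excess := fun n =>
    Finset.sum_nonneg fun g _ => mul_nonneg measureReal_nonneg (excess_nonneg (by omega))
  refine le_add_of_summable_increments
    (s := fun n : ℕ => 2 * (m + n : ℕ) * stateExp μ G (m + n) excess)
    (fun n => mul_nonneg (by positivity) (hb0 n)) ?_ fun n => ?_
  · have h0 : Summable fun n : ℕ => 2 * D * (m * ρ ^ n + (n : ℝ) ^ 1 * ρ ^ n) := by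
      refine Summable.mul_left _ (Summable.add ?_ ?_)
      · exact (summable_geometric_of_lt_one hρ0 hρ1).mul_left _
      · exact summable_pow_mul_geometric_of_norm_lt_one 1
          (by rwa [Real.norm_of_nonneg hρ0])
    refine Summable.of_nonneg_of_le (fun n => mul_nonneg (by positivity) (hb0 n)) (fun n => ?_) h0
    refine (mul_le_mul_of_nonneg_left (hD n) (by positivity)).trans (le_of_eq ?_)
    push_cast
    ring
  · have key := hG.stateExp_succ_le (N := m + n) (by omega) (hpos n)
      (fun g => ((maxDeg g : ℝ) - (1 - r) * (m + (n + 1) : ℕ)) ^ 2)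
      (f' := fun g => ((maxDeg g : ℝ) - (1 - r) * (m + n : ℕ)) ^ 2 + 1
        + 2 * (m + n : ℕ) * excess g) fun g hg => by
          have := sum_attachProb_mul_sq_le hr0 hr1 hg
          push_cast [← add_assoc] at this ⊢
          exact this
    rwa [stateExp_add, stateExp_add, stateExp_const_mul, stateExp_one hG (by omega)] at key

/-- Almost surely, the maximum degree grows at rate `1 - r` along the squares. -/
lemma IsProcess.ae_tendsto_maxDeg_sq [IsProbabilityMeasure μ] (hG : IsProcess μ r T G)
    (hr0 : 0 ≤ r) (hr1 : r < 1) (hm : 2 ≤ m) (hT : T.IsTree) :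
    ∀ᵐ ω ∂μ, Tendsto (fun n : ℕ => (maxDeg (G (m + (n + 1) ^ 2) ω) : ℝ) / ((n + 1) ^ 2 : ℕ))
      atTop (𝓝 (1 - r)) := by
  obtain ⟨C, hC0, hC⟩ := hG.stateExp_sq_le hr0 hr1 hm hT
  -- Chebyshev: a second moment O(n²) against a squared threshold of order n⁴ is summable. The
  -- tolerances 1/(j + 1) keep the exceptional null sets countable in number.
  have h1 : ∀ j : ℕ, ∀ᵐ ω ∂μ, ∀ᶠ n : ℕ in atTop,
      |(maxDeg (G (m + (n + 1) ^ 2) ω) : ℝ) - (1 - r) * (m + (n + 1) ^ 2 : ℕ)|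
        < ((n : ℝ) + 1) ^ 2 / (j + 1) := by
    intro j
    have hs : Summable fun n : ℕ => (C + 1) * ((j : ℝ) + 1) ^ 2 * (1 / ((n + 1 : ℕ) : ℝ) ^ 2) :=
      ((summable_nat_add_iff 1).2 (Real.summable_one_div_nat_pow.2 one_lt_two)).mul_left _
    refine ae_eventually_of_summable hs fun n => ?_
    have hn : (0 : ℝ) < (n : ℝ) + 1 := by positivity
    have hj : (0 : ℝ) < (j : ℝ) + 1 := by positivity
    refine le_trans (hG.measureReal_le_stateExp (by omega) (hG.ae_one_le_maxDeg hm hT (by omega))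
      (f := fun g => (((j : ℝ) + 1) / ((n : ℝ) + 1) ^ 2) ^ 2
        * ((maxDeg g : ℝ) - (1 - r) * (m + (n + 1) ^ 2 : ℕ)) ^ 2)
      (fun g _ => by positivity)
      (fun g => ¬ |(maxDeg g : ℝ) - (1 - r) * (m + (n + 1) ^ 2 : ℕ)| < ((n : ℝ) + 1) ^ 2 / (j + 1))
      fun g _ h => ?_) ?_
    · rw [not_lt, div_le_iff₀ hj] at h
      rw [← mul_pow, ← sq_abs]
      refine one_le_pow₀ ?_
      rw [abs_mul, abs_of_pos (by positivity), div_mul_eq_mul_div, one_le_div (by positivity)]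
      linarith
    · rw [stateExp_const_mul]
      refine (mul_le_mul_of_nonneg_left (hC _) (by positivity)).trans ?_
      push_cast
      rw [div_pow, div_mul_eq_mul_div, mul_one_div, div_le_div_iff₀ (by positivity) (by positivity)]
      have h2 : C + ((n : ℝ) + 1) ^ 2 ≤ (C + 1) * ((n : ℝ) + 1) ^ 2 := by
        have : (1 : ℝ) ≤ ((n : ℝ) + 1) ^ 2 := one_le_pow₀ (by linarith)
        nlinarith
      calc ((j : ℝ) + 1) ^ 2 * (C + ((n : ℝ) + 1) ^ 2) * ((n : ℝ) + 1) ^ 2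
          ≤ ((j : ℝ) + 1) ^ 2 * ((C + 1) * ((n : ℝ) + 1) ^ 2) * ((n : ℝ) + 1) ^ 2 := by gcongr
        _ = _ := by ring
  filter_upwards [ae_all_iff.2 h1] with ω hω
  have h2 : Tendsto (fun n : ℕ => ((maxDeg (G (m + (n + 1) ^ 2) ω) : ℝ)
      - (1 - r) * (m + (n + 1) ^ 2 : ℕ)) / ((n : ℝ) + 1) ^ 2) atTop (𝓝 0) := by
    rw [Metric.tendsto_nhds]
    intro ε hε
    obtain ⟨j, hj⟩ := exists_nat_one_div_lt hε
    filter_upwards [hω j] with n hn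
    rw [Real.dist_eq, sub_zero, abs_div, abs_of_pos (a := ((n : ℝ) + 1) ^ 2) (by positivity),
      div_lt_iff₀ (by positivity)]
    refine hn.trans ?_
    rw [div_eq_mul_one_div, mul_comm]
    exact mul_lt_mul_of_pos_right hj (by positivity)
  have h3 : Tendsto (fun n : ℕ => (1 - r) * m * (1 / ((n : ℝ) + 1) ^ 2)) atTop (𝓝 0) := by
    have h4 := (tendsto_one_div_add_atTop_nhds_zero_nat (𝕜 := ℝ)).pow 2
    simp only [div_pow, one_pow] at h4
    simpa using h4.const_mul ((1 - r) * m)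
  have h5 := (h2.add h3).add_const (1 - r)
  rw [add_zero, zero_add] at h5
  refine h5.congr fun n => ?_
  have : ((n : ℝ) + 1) ≠ 0 := by positivity
  push_cast
  field_simp
  ring

/-- Ratios of consecutive squares tend to 1, so monotonicity leaves no room to deviate between them.
-/
lemma tendsto_div_of_monotone_of_tendsto_sq {u : ℕ → ℝ} {l : ℝ} (hu : Monotone u)
    (h : Tendsto (fun n : ℕ => u ((n + 1) ^ 2) / ((n + 1) ^ 2 : ℕ)) atTop (𝓝 l)) :
    Tendsto (fun n => u n / n) atTop (𝓝 l) := by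
  refine tendsto_div_of_monotone_of_exists_subseq_tendsto_div u l hu fun a ha =>
    ⟨fun n => (n + 1) ^ 2, ?_, ?_, h⟩
  · have h1 : Tendsto (fun n : ℕ => (1 + 1 / ((n : ℝ) + 1)) ^ 2) atTop (𝓝 1) := by
      simpa using ((tendsto_one_div_add_atTop_nhds_zero_nat (𝕜 := ℝ)).const_add 1).pow 2
    filter_upwards [h1.eventually_lt_const ha] with n hn
    have h2 : ((n : ℝ) + 1 + 1) ^ 2 = (1 + 1 / ((n : ℝ) + 1)) ^ 2 * ((n : ℝ) + 1) ^ 2 := by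
      have : ((n : ℝ) + 1) ≠ 0 := by positivity
      field_simp
    push_cast
    rw [h2]
    exact mul_le_mul_of_nonneg_right hn.le (by positivity)
  · exact (tendsto_pow_atTop two_ne_zero).comp (tendsto_add_atTop_nat 1)

end Asymptotics

end CRModel

end

theorem mainTheorem5 {Ω : Type*} [MeasurableSpace Ω] (μ : Measure Ω) [IsProbabilityMeasure μ]
    (r : ℝ) (hr0 : 0 ≤ r) (hr1 : r < 1)
    (m : ℕ) (hm : 2 ≤ m) (T : SimpleGraph (Fin m)) (hT : T.IsTree)
    (G : (N : ℕ) → Ω → SimpleGraph (Fin N)) (hG : CRModel.IsProcess μ r T G) :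
    ∀ᵐ ω ∂μ, ∃ k : ℕ,
      (∀ᶠ N in atTop, CRModel.IsUniqueKing (G N ω) k) ∧
      Tendsto (fun N : ℕ => (CRModel.labelDeg (G N ω) k : ℝ) / (N : ℝ)) atTop (𝓝 (1 - r)) := by
  have hpos : ∀ᵐ ω ∂μ, ∀ n, 1 ≤ CRModel.maxDeg (G (m + n) ω) :=
    ae_all_iff.2 fun n => hG.ae_one_le_maxDeg hm hT (by omega)
  have hatt : ∀ᵐ ω ∂μ, ∀ n, ∃ v, G (m + n + 1) ω = CRModel.attach (G (m + n) ω) v :=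
    ae_all_iff.2 fun n =>
      hG.ae_attach_of_ae (by omega) (hG.ae_one_le_maxDeg hm hT (by omega))
  filter_upwards [hpos, hatt, hG.ae_eventually_card_kings_eq_one hr0 hr1 hm hT,
    hG.ae_tendsto_maxDeg_sq hr0 hr1 hm hT] with ω hpos hatt hcard hsq
  obtain ⟨n₀, hn₀⟩ := eventually_atTop.1 hcard
  obtain ⟨k, hk⟩ := Finset.card_eq_one.1 (hn₀ n₀ le_rfl)
  have hking : ∀ n, n₀ ≤ n → CRModel.IsUniqueKing (G (m + n) ω) k := by
    intro n hn
    induction n, hn using Nat.le_induction with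
    | base => exact CRModel.isUniqueKing_of_kings_eq hk
    | succ n hn ih =>
      obtain ⟨v, hv⟩ := hatt n
      have h1 := hn₀ (n + 1) (by omega)
      rw [← add_assoc, hv] at h1 ⊢
      exact ih.attach (hpos n) h1
  have hking' : ∀ᶠ N in atTop, CRModel.IsUniqueKing (G N ω) k := by
    filter_upwards [eventually_ge_atTop (m + n₀)] with N hN
    obtain ⟨n, rfl⟩ := Nat.exists_eq_add_of_le (show m ≤ N by omega)
    exact hking n (by omega)
  refine ⟨k, hking', ?_⟩
  have hmono : Monotone fun n => (CRModel.maxDeg (G (m + n) ω) : ℝ) := by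
    refine monotone_nat_of_le_succ fun n => ?_
    obtain ⟨v, hv⟩ := hatt n
    rw [← add_assoc, hv]
    exact_mod_cast CRModel.maxDeg_le_maxDeg_attach _ v
  have hlim := CRModel.tendsto_div_of_monotone_of_tendsto_sq hmono hsq
  rw [← tendsto_add_atTop_iff_nat m]
  -- The limit so far divides by n = N - m; the factor n / (n + m) → 1 restores division by N.
  have h1 := hlim.mul (tendsto_natCast_div_add_atTop (m : ℝ))
  rw [mul_one] at h1
  refine h1.congr' ?_
  filter_upwards [eventually_ge_atTop n₀, eventually_gt_atTop 0] with n hn hn0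
  rw [add_comm n m, CRModel.labelDeg_of_isUniqueKing (hking n hn)]
  have : (n : ℝ) ≠ 0 := by exact_mod_cast hn0.ne'
  push_cast
  rw [div_mul_div_comm, mul_comm _ (n : ℝ), mul_div_mul_left _ _ this, add_comm (n : ℝ)]
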